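/- **Setting.** An input of the sorting problem with uncertainty consists of intervals $I_i=[\ell_i,r_i]$ ($1\le i\le n$), unknown values $v_i\in I_i$, arbitrary query costs $w_i\ge 0$, and an error threshold $\delta\ge 0$. Querying $I_i$ reveals $v_i$ and replaces $I_i$ by $[v_i,v_i]$. A set $Q$ of queries *solves* the input if there is a permutation $\pi$ such that, for all $x_1,\dots,x_n$ with $x_i\in I_i$ for every $i$ and $x_i=v_i$ for $i\in Q$, we have $x_i\le x_j+\delta$ whenever $\pi(i)<\pi(j)$. Let $\mathrm{OPT}$ be the minimum of $\sum_{i\in Q}w_i$ over all $Q$ that solve the input. Two distinct current intervals $i,j$ are *dependent* if $r_i-\ell_j>\delta$ and $r_j-\ell_i>\delta$; the dependency graph has the intervals as vertices and the dependent pairs as edges. **Algorithm (with parameter $\tau>0$).** Keep current costs $u$, initially $u=w$. While some dependency remains, do the first of the following that applies. 1. If some interval $I_i$ not yet queried has $u_i=0$, query it. 2. If the dependency graph has a triangle $abc$, subtract $\min(u_a,u_b,u_c)$ from each of $u_a,u_b,u_c$. 3. Otherwise take a longest path $P=abc\cdots$ with at least two vertices in some connected component (possibly $P=ab$, with no $c$).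 Let $N_1(b)$ be the set of neighbours of $b$ other than $c$, and $u(N_1(b))=\sum_{j\in N_1(b)}u_j$. With probability $p=\min\bigl(1,\tfrac{u(N_1(b))}{\tau\,u_b}\bigr)$ query $I_b$; otherwise query all intervals in $N_1(b)$. After each such iteration, as long as there are an interval $I_i=[\ell_i,r_i]$ not yet queried and an already queried $j$ with $\ell_i<v_j-\delta$ and $v_j+\delta<r_i$, query $I_i$. **Theorem.** On every input, and for every rule (possibly depending on the history) that resolves the arbitrary choices of an interval, a triangle or a longest path, the algorithm always stops after a bounded number of steps, and its set of queries solves the input. Its expected total query cost, measured in the original costs $w$, is at most $\alpha\cdot\mathrm{OPT}$, where * $\alpha=1+\frac{4}{3\sqrt3}\approx 1.7698$ for $\tau=\sqrt3$, i.e. $p=\min\bigl(1,\tfrac{u(N_1(b))}{u_b\sqrt3}\bigr)$; * $\alpha=\frac{57}{32}$ for $\tau=2$, i.e. $p=\min\bigl(1,\tfrac{u(N_1(b))}{2u_b}\bigr)$. -/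

import Mathlib

noncomputable section

namespace QuerySort

/-- An input of the sorting problem with uncertainty: intervals `[lo i, hi i]`, nonnegative query
costs, an error threshold, and the actual values, which an algorithm learns only by querying. -/
structure Input (n : ℕ) where
  lo : Fin n → ℝ
  hi : Fin n → ℝ
  val : Fin n → ℝ
  cost : Fin n → ℝ
  δ : ℝ
  lo_le_val : ∀ i, lo i ≤ val i
  val_le_hi : ∀ i, val i ≤ hi i
  cost_nonneg : ∀ i, 0 ≤ cost i
  δ_nonneg : 0 ≤ δ

variable {n : ℕ}

/-- Querying exactly the intervals in `Q` is enough to solve the problem: there is an ordering that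
is correct, up to `δ`, for every vector of values that agrees with the outcome of the queries. -/
def Input.Solves (I : Input n) (Q : Finset (Fin n)) : Prop :=
  ∃ π : Equiv.Perm (Fin n), ∀ x : Fin n → ℝ,
    (∀ i, I.lo i ≤ x i ∧ x i ≤ I.hi i) → (∀ i ∈ Q, x i = I.val i) →
      ∀ i j, π i < π j → x i ≤ x j + I.δ

/-- The total query cost of a set of queries. -/
def Input.queryCost (I : Input n) (Q : Finset (Fin n)) : ℝ := ∑ i ∈ Q, I.cost i

theorem Input.solves_univ (I : Input n) : I.Solves Finset.univ := by
  refine ⟨(Tuple.sort I.val).symm, fun x _ hx i j hij => ?_⟩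
  have h := Tuple.monotone_sort I.val hij.le
  simp only [Function.comp_apply, Equiv.apply_symm_apply] at h
  rw [hx i (Finset.mem_univ i), hx j (Finset.mem_univ j)]
  linarith [I.δ_nonneg]

open Classical in
theorem Input.filter_solves_nonempty (I : Input n) :
    (Finset.univ.filter fun Q : Finset (Fin n) => I.Solves Q).Nonempty :=
  ⟨Finset.univ, Finset.mem_filter.2 ⟨Finset.mem_univ _, I.solves_univ⟩⟩

open Classical in
/-- The cost of an offline optimum query set. -/
def Input.optCost (I : Input n) : ℝ :=
  (Finset.univ.filter fun Q : Finset (Fin n) => I.Solves Q).inf' I.filter_solves_nonempty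
    I.queryCost

/-- What the algorithm stores: the intervals queried so far, and its current (modified) costs. -/
structure State (n : ℕ) where
  queried : Finset (Fin n)
  cost : Fin n → ℝ

/-- At the start nothing is queried and the costs are those of the input. -/
def Input.initial (I : Input n) : State n := ⟨∅, I.cost⟩

/-- Left endpoints of the current intervals: a queried interval is replaced by `[val i, val i]`. -/
def Input.curLo (I : Input n) (s : State n) (i : Fin n) : ℝ :=
  if i ∈ s.queried then I.val i else I.lo i

/-- Right endpoints of the current intervals. -/
def Input.curHi (I : Input n) (s : State n) (i : Fin n) : ℝ :=
  if i ∈ s.queried then I.val i else I.hi i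

/-- The dependency graph of the current intervals. -/
def Input.depGraph (I : Input n) (s : State n) : SimpleGraph (Fin n) where
  Adj i j := i ≠ j ∧ I.δ < I.curHi s i - I.curLo s j ∧ I.δ < I.curHi s j - I.curLo s i
  symm := ⟨fun _ _ h => ⟨h.1.symm, h.2.2, h.2.1⟩⟩
  loopless := ⟨fun _ h => h.1 rfl⟩

/-- There is no dependency left; the algorithm stops. -/
def Input.Halted (I : Input n) (s : State n) : Prop := ∀ i j, ¬ (I.depGraph s).Adj i j

/-- The interval `i` is not queried yet and contains `[v j - δ, v j + δ]` in its interior for some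
value `v j` that is already known. -/
def Input.Forced (I : Input n) (s : State n) (i : Fin n) : Prop :=
  i ∉ s.queried ∧ ∃ j ∈ s.queried, I.lo i < I.val j - I.δ ∧ I.val j + I.δ < I.hi i

/-- `p` is a longest path of the connected component in which it lies. -/
def IsLongestPath {V : Type*} {G : SimpleGraph V} {x y : V} (p : G.Walk x y) : Prop :=
  p.IsPath ∧ ∀ (x' y' : V) (q : G.Walk x' y'), q.IsPath → G.Reachable x x' → q.length ≤ p.length

/-- The elementary operations of the algorithm. `forced i` is one pass of the inner loop. `trial b N`
is the random trial that queries either `b` or every interval in `N`. -/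
inductive Move (n : ℕ) where
  | forced (i : Fin n)
  | zeroCost (i : Fin n)
  | triangle (a b c : Fin n)
  | trial (b : Fin n) (N : Finset (Fin n))

open Classical in
/-- The operations among which the algorithm may choose in a given state. Each kind is available only
if no earlier kind is. In the last case `a b c ⋯` is a longest path with at least two vertices in a
component; `p.getVert 1` is `b`, and `p.getVert 2` is `c` (if the path has just the two vertices `a`
and `b`, then `p.getVert 2 = b`, and all neighbours of `b` are taken). -/
def Input.Legal (I : Input n) (s : State n) : Move n → Prop
  | .forced i => I.Forced s i
  | .zeroCost i => (∀ k, ¬ I.Forced s k) ∧ i ∉ s.queried ∧ s.cost i = 0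
  | .triangle a b c => (∀ k, ¬ I.Forced s k) ∧ (∀ k, k ∉ s.queried → s.cost k ≠ 0) ∧
      (I.depGraph s).Adj a b ∧ (I.depGraph s).Adj b c ∧ (I.depGraph s).Adj a c
  | .trial b N => (∀ k, ¬ I.Forced s k) ∧ (∀ k, k ∉ s.queried → s.cost k ≠ 0) ∧
      (I.depGraph s).CliqueFree 3 ∧
      ∃ (x y : Fin n) (p : (I.depGraph s).Walk x y), IsLongestPath p ∧ 1 ≤ p.length ∧
        b = p.getVert 1 ∧
        N = Finset.univ.filter fun j => (I.depGraph s).Adj b j ∧ j ≠ p.getVert 2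

/-- The probability `min (1, w(N) / (τ w_b))` of querying `b` in a random trial. -/
def trialProb (τ : ℝ) (s : State n) (b : Fin n) (N : Finset (Fin n)) : NNReal :=
  (min 1 ((∑ j ∈ N, s.cost j) / (τ * s.cost b))).toNNReal

theorem trialProb_le_one (τ : ℝ) (s : State n) (b : Fin n) (N : Finset (Fin n)) :
    trialProb τ s b N ≤ 1 :=
  Real.toNNReal_le_one.2 (min_le_left _ _)

/-- A coin that shows `true` with probability `p`. -/
def biasedCoin (p : NNReal) (hp : p ≤ 1) : PMF Bool :=
  PMF.ofFintype (fun b => if b then (p : ENNReal) else ((1 - p : NNReal) : ENNReal)) (by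
    simp only [Fintype.sum_bool, if_true, Bool.false_eq_true, if_false]
    exact_mod_cast add_tsub_cancel_of_le hp)

/-- The distribution of the state after an operation. -/
def applyMove (τ : ℝ) (s : State n) : Move n → PMF (State n)
  | .forced i => PMF.pure ⟨insert i s.queried, s.cost⟩
  | .zeroCost i => PMF.pure ⟨insert i s.queried, s.cost⟩
  | .triangle a b c => PMF.pure ⟨s.queried, fun j =>
      if j = a ∨ j = b ∨ j = c then s.cost j - min (s.cost a) (min (s.cost b) (s.cost c))
      else s.cost j⟩
  | .trial b N => (biasedCoin (trialProb τ s b N) (trialProb_le_one τ s b N)).map fun coin =>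
      if coin then ⟨insert b s.queried, s.cost⟩ else ⟨s.queried ∪ N, s.cost⟩

/-- A rule that resolves the arbitrary choices of the algorithm (which interval, which triangle,
which longest path). It sees the current state and the list of all earlier states, latest first. -/
structure Rule (I : Input n) where
  move : ∀ s : State n, List (State n) → ¬ I.Halted s → Move n
  legal : ∀ s past (hs : ¬ I.Halted s), I.Legal s (move s past hs)

open Classical in
/-- One step of the algorithm, on pairs (current state, earlier states). -/
def step (I : Input n) (τ : ℝ) (σ : Rule I) (c : State n × List (State n)) :
    PMF (State n × List (State n)) :=
  if hc : I.Halted c.1 then PMF.pure c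
  else (applyMove τ c.1 (σ.move c.1 c.2 hc)).map fun s => (s, c.1 :: c.2)

/-- The distribution of (current state, earlier states) after `t` steps. -/
def run (I : Input n) (τ : ℝ) (σ : Rule I) : ℕ → PMF (State n × List (State n))
  | 0 => PMF.pure (I.initial, [])
  | t + 1 => (run I τ σ t).bind (step I τ σ)

/-- The distribution of the set of intervals queried in the first `t` steps. -/
def queriedAfter (I : Input n) (τ : ℝ) (σ : Rule I) (t : ℕ) : PMF (Finset (Fin n)) :=
  (run I τ σ t).map fun c => c.1.queried

/-- The expected cost, in the costs of the input, of the queries made in the first `t` steps. -/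
def expectedCost (I : Input n) (τ : ℝ) (σ : Rule I) (t : ℕ) : ℝ :=
  ∑ S : Finset (Fin n), (queriedAfter I τ σ t S).toReal * I.queryCost S

/-- The algorithm with trial probability `min (1, w(N) / (τ w_b))` has expected query-competitive
ratio `α`: on every input, and however its choices are resolved, it surely stops after a bounded
number of steps, its queries then solve the problem, and their expected cost is at most `α` times
the cost of an offline optimum query set. -/
def HasExpectedRatio (τ α : ℝ) : Prop :=
  ∀ (n : ℕ) (I : Input n) (σ : Rule I), ∃ t : ℕ,
    (∀ c ∈ (run I τ σ t).support, I.Halted c.1 ∧ I.Solves c.1.queried) ∧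
      expectedCost I τ σ t ≤ α * I.optCost

/-- As long as some dependency remains, the algorithm can continue. -/
theorem Input.exists_legal (I : Input n) (s : State n) (hs : ¬ I.Halted s) :
    ∃ m, I.Legal s m := by
  classical
  by_cases h1 : ∃ k, I.Forced s k
  · obtain ⟨k, hk⟩ := h1
    exact ⟨.forced k, hk⟩
  have h1' : ∀ k, ¬ I.Forced s k := fun k hk => h1 ⟨k, hk⟩
  by_cases h2 : ∃ k, k ∉ s.queried ∧ s.cost k = 0
  · obtain ⟨k, hk⟩ := h2
    exact ⟨.zeroCost k, h1', hk⟩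
  have h2' : ∀ k, k ∉ s.queried → s.cost k ≠ 0 := fun k hk h => h2 ⟨k, hk, h⟩
  by_cases h3 : (I.depGraph s).CliqueFree 3
  · simp only [Input.Halted, not_forall, not_not] at hs
    obtain ⟨i, j, hij⟩ := hs
    let P : ℕ → Prop := fun k => ∃ (x y : Fin n) (p : (I.depGraph s).Walk x y),
      p.IsPath ∧ (I.depGraph s).Reachable i x ∧ p.length = k
    have hP1 : P 1 := ⟨i, j, hij.toWalk, by simp [hij.ne], SimpleGraph.Reachable.refl i, by simp⟩
    have hb : ∀ k, P k → k ≤ n := by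
      rintro k ⟨x, y, p, hp, -, rfl⟩
      simpa using hp.length_lt.le
    have hn : 1 ≤ n := hb 1 hP1
    obtain ⟨x, y, p, hp, hx, hl⟩ := Nat.findGreatest_spec hn hP1
    have hmax : ∀ k, P k → k ≤ p.length := fun k hk => by
      rw [hl]
      exact Nat.le_findGreatest (hb k hk) hk
    exact ⟨.trial (p.getVert 1) _, h1', h2', h3, x, y, p,
      ⟨hp, fun x' y' q hq hr => hmax _ ⟨x', y', q, hq, hx.trans hr, rfl⟩⟩,
      hmax 1 hP1, rfl, rfl⟩
  · simp only [SimpleGraph.CliqueFree, not_forall, not_not] at h3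
    obtain ⟨t, ht⟩ := h3
    obtain ⟨a, b, c, hab, hac, hbc, -⟩ := SimpleGraph.is3Clique_iff.1 ht
    exact ⟨.triangle a b c, h1', h2', hab, hbc, hac⟩

/-- Every input has at least one rule. -/
theorem Rule.nonempty (I : Input n) : Nonempty (Rule I) :=
  ⟨⟨fun s _ hs => (I.exists_legal s hs).choose, fun s _ hs => (I.exists_legal s hs).choose_spec⟩⟩

end QuerySort

end

/-!
The algorithm is analysed by the local ratio method, with a potential that is a supermartingale.

A solution contains one of any two dependent intervals, and it contains every interval that is
pinned by a value, i.e. has `[v j - δ, v j + δ]` in its interior for some other `j`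
(`Input.Solves.mem_or_mem`, `Input.Solves.mem_of_pinned`). When no query is forced, dependencies
exist only between intervals not yet queried, so the dependency graph is then an induced subgraph
of the initial one. If it has no triangle, it is a forest (`Input.isAcyclic_depGraph`), because in
any cycle the two neighbours of the vertex with the smallest right endpoint are dependent. Hence in
a trial on `b` with third vertex `c`, all members of `N` are leaves (`IsLongestPath.eq_of_adj`): if
`b` is queried, they become isolated or pinned, and if `N` is queried, then `b` becomes a leaf
attached to `c`, isolated or pinned (`Input.isTrial_of_legal`).

Fix an optimum query set `Q`, and give each member of `Q` not yet queried, with current cost `u`, a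
credit: `u` if it is pinned, `α u` if its degree is at least two, `(1 + 1/τ) u` for a leaf, and `0`
for an isolated vertex. The potential is the cost paid so far, plus the amounts subtracted in
triangles from intervals not yet queried, plus all credits. It is at most `α * OPT` at the start
and never less than the query cost, and it does not increase in expectation:
* credits only decrease (`Input.credit_anti`), which settles forced queries and queries of cost `0`;
* a solution contains two vertices of each triangle, and `2 α ≥ 3`
  (`Input.potential_triangle_le`);
* for a trial with probability `p`, where `W` is the cost of the leaves and `B` that of the center
  (`IsAdmissible.potential_trial_le`): if `b ∉ Q`, all leaves are in `Q`, and `p B ≤ W / τ` is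
  covered by the share `1/τ` in their credits. If `b ∈ Q` has degree at least two, then `W = τ p B`
  unless `p = 1`, and the credit of `b` has to cover `p B + (1 - p) (τ p B + (1 + 1/τ) B)`, i.e.
  `(1 - p) (τ p + 1/τ) ≤ α - 1` is needed. If `b ∈ Q` is a leaf, `τ / 4 ≤ 1 / τ` is enough.

The maximum of `(1 - p) (τ p + 1/τ)` is `4 / (3 √3)` for `τ = √3`, at `p = 1/3`, and `25 / 32` for
`τ = 2`, at `p = 3/8`. Every step decreases the number of intervals not yet queried plus the number
of those with nonzero cost (`Input.remaining_lt`), so at most `2 n` steps are made; and when no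
dependency is left, ordering the current intervals by midpoint is correct (`Input.Halted.solves`).
-/

noncomputable section

namespace QuerySort

variable {n : ℕ}

/-! ### Longest paths in forests -/

theorem _root_.SimpleGraph.IsAcyclic.eq_getVert_one {V : Type*} {G : SimpleGraph V}
    (hG : G.IsAcyclic) {u v z : V} (q : G.Walk u v) (hq : q.IsPath) (h : G.Adj u z)
    (hz : z ∈ q.support) : z = q.getVert 1 := by
  obtain ⟨m, rfl, hm⟩ := SimpleGraph.Walk.mem_support_iff_exists_getVert.1 hz
  have h1 : (h.toWalk).IsPath := by simp [h.ne]
  have h2 := congrArg (fun p => p.1.length)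
    ((hG.subsingleton_path _ _).elim ⟨q.take m, hq.take m⟩ ⟨_, h1⟩)
  simp only [SimpleGraph.Walk.take_length, SimpleGraph.Walk.length_cons,
    SimpleGraph.Walk.length_nil, min_eq_left hm] at h2
  rw [h2]

/-- In a forest, if `a b c ⋯` is a longest path, then every neighbour of `b` other than `c` is a
leaf: otherwise the path could be rerouted through that neighbour and prolonged. -/
theorem IsLongestPath.eq_of_adj {V : Type*} {G : SimpleGraph V} (hG : G.IsAcyclic) {x y : V}
    {p : G.Walk x y} (hp : IsLongestPath p) (hl : 1 ≤ p.length) {j k : V}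
    (hbj : G.Adj (p.getVert 1) j) (hj : j ≠ p.getVert 2) (hjk : G.Adj j k) :
    k = p.getVert 1 := by
  have hq : (p.drop 1).IsPath := hp.1.drop 1
  have hjq : j ∉ (p.drop 1).support := fun h => hj <| by
    simpa [SimpleGraph.Walk.drop_getVert] using hG.eq_getVert_one _ hq hbj h
  have hq' : (SimpleGraph.Walk.cons hbj.symm (p.drop 1)).IsPath := hq.cons hjq
  by_cases hk : k ∈ (SimpleGraph.Walk.cons hbj.symm (p.drop 1)).support
  · simpa using hG.eq_getVert_one _ hq' hjk hk
  · have h := hp.2 _ _ _ (hq'.cons (h := hjk.symm) hk)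
      (((p.take 1).reachable.trans hbj.reachable).trans hjk.reachable)
    simp only [SimpleGraph.Walk.length_cons, SimpleGraph.Walk.drop_length] at h
    omega

/-! ### The dependency graph -/

theorem Input.curLo_le_curHi (I : Input n) (s : State n) (i : Fin n) :
    I.curLo s i ≤ I.curHi s i := by
  unfold Input.curLo Input.curHi
  split_ifs
  · exact le_rfl
  · exact (I.lo_le_val i).trans (I.val_le_hi i)

/-- On a cycle of the dependency graph, the two neighbours of a vertex with the smallest right
endpoint are dependent on each other; so a dependency graph without triangles is a forest. -/
theorem Input.isAcyclic_depGraph (I : Input n) (s : State n) (h3 : (I.depGraph s).CliqueFree 3) :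
    (I.depGraph s).IsAcyclic := by
  classical
  intro v c hc
  obtain ⟨i, hi, hmin⟩ := Finset.exists_min_image c.support.toFinset (I.curHi s)
    ⟨v, by simp⟩
  rw [List.mem_toFinset] at hi
  have hc' : (c.rotate i hi).IsCycle := by simpa using hc
  set d := c.rotate i hi with hd
  have hm : ∀ x ∈ d.support, I.curHi s i ≤ I.curHi s x := fun x hx =>
    hmin x (by rw [List.mem_toFinset]; exact (SimpleGraph.Walk.mem_support_rotate_iff c i hi).1 hx)
  have hx : (I.depGraph s).Adj i d.snd := SimpleGraph.Walk.adj_snd hc'.not_nil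
  have hy : (I.depGraph s).Adj d.penultimate i := SimpleGraph.Walk.adj_penultimate hc'.not_nil
  have hxm := hm _ (d.getVert_mem_support 1 : d.snd ∈ d.support)
  have hym := hm _ (d.getVert_mem_support _ : d.penultimate ∈ d.support)
  refine h3 {i, d.snd, d.penultimate} (SimpleGraph.is3Clique_triple_iff.2 ⟨hx, hy.symm,
    hc'.snd_ne_penultimate, ?_, ?_⟩)
  · linarith [hy.2.2, hy.2.1]
  · linarith [hx.2.1]

/-- Dependency of the intervals as given in the input. -/
def Input.Dep (I : Input n) (i j : Fin n) : Prop :=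
  i ≠ j ∧ I.δ < I.hi i - I.lo j ∧ I.δ < I.hi j - I.lo i

theorem Input.Dep.symm {I : Input n} {i j : Fin n} (h : I.Dep i j) : I.Dep j i :=
  ⟨h.1.symm, h.2.2, h.2.1⟩

/-- When no query is forced, dependencies exist only between intervals not yet queried. -/
theorem Input.depGraph_adj_iff (I : Input n) (s : State n) (hF : ∀ k, ¬ I.Forced s k)
    (i j : Fin n) : (I.depGraph s).Adj i j ↔ i ∉ s.queried ∧ j ∉ s.queried ∧ I.Dep i j := by
  have hF' : ∀ k ∉ s.queried, ∀ l ∈ s.queried, I.lo k < I.val l - I.δ →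
      I.val l + I.δ < I.hi k → False := fun k hk l hl h1 h2 => hF k ⟨hk, l, hl, h1, h2⟩
  simp only [Input.depGraph, Input.curLo, Input.curHi, Input.Dep]
  have h0 := I.δ_nonneg
  by_cases hi : i ∈ s.queried <;> by_cases hj : j ∈ s.queried
  · simp only [hi, hj, if_true, not_true, false_and, iff_false]
    rintro ⟨-, h1, h2⟩
    linarith
  · simp only [hi, hj, if_true, if_false, not_true, false_and, iff_false]
    rintro ⟨-, h1, h2⟩
    exact hF' j hj i hi (by linarith) (by linarith)
  · simp only [hi, hj, if_true, if_false, not_true, false_and, and_false, iff_false]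
    rintro ⟨-, h1, h2⟩
    exact hF' i hi j hj (by linarith) (by linarith)
  · simp [hi, hj]

/-! ### Query sets that solve the problem -/

theorem Input.Solves.le_or_le {I : Input n} {Q : Finset (Fin n)} (hQ : I.Solves Q)
    {i j : Fin n} (hij : i ≠ j) {x y : Fin n → ℝ} (hx : ∀ k, I.lo k ≤ x k ∧ x k ≤ I.hi k)
    (hxQ : ∀ k ∈ Q, x k = I.val k) (hy : ∀ k, I.lo k ≤ y k ∧ y k ≤ I.hi k)
    (hyQ : ∀ k ∈ Q, y k = I.val k) : x i ≤ x j + I.δ ∨ y j ≤ y i + I.δ := by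
  obtain ⟨π, hπ⟩ := hQ
  rcases lt_or_gt_of_ne (π.injective.ne hij) with h | h
  · exact .inl (hπ x hx hxQ i j h)
  · exact .inr (hπ y hy hyQ j i h)

theorem Input.Solves.mem_or_mem {I : Input n} {Q : Finset (Fin n)} (hQ : I.Solves Q)
    {i j : Fin n} (h : I.Dep i j) : i ∈ Q ∨ j ∈ Q := by
  by_contra! hn
  have hb : ∀ k, I.lo k ≤ I.val k ∧ I.val k ≤ I.hi k := fun k => ⟨I.lo_le_val k, I.val_le_hi k⟩
  have hc : ∀ k, I.lo k ≤ I.hi k := fun k => (hb k).1.trans (hb k).2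
  have key := hQ.le_or_le h.1
    (x := fun k => if k = i then I.hi k else if k = j then I.lo k else I.val k)
    (y := fun k => if k = i then I.lo k else if k = j then I.hi k else I.val k)
    (fun k => by split_ifs <;> simp [hb, hc])
    (fun k hk => by
      rw [if_neg (ne_of_mem_of_not_mem hk hn.1), if_neg (ne_of_mem_of_not_mem hk hn.2)])
    (fun k => by split_ifs <;> simp [hb, hc])
    (fun k hk => by
      rw [if_neg (ne_of_mem_of_not_mem hk hn.1), if_neg (ne_of_mem_of_not_mem hk hn.2)])
  simp only [if_true, if_neg h.1.symm] at key
  rcases key with k | k <;> linarith [h.2.1, h.2.2]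

/-- The interval `i` is pinned by the set `A` if the value of some member of `A` lies, with margin
`δ`, in its interior. An interval that is forced in a state is one that is not yet queried and is
pinned by the set of queried intervals. -/
def Input.Pinned (I : Input n) (A : Finset (Fin n)) (i : Fin n) : Prop :=
  ∃ j ∈ A, I.lo i < I.val j - I.δ ∧ I.val j + I.δ < I.hi i

/-- A pinned interval belongs to every solution `Q`, even if the interval that pins it does not:
the value of the latter is in any case possible. -/
theorem Input.Solves.mem_of_pinned {I : Input n} {Q A : Finset (Fin n)} (hQ : I.Solves Q)
    {i : Fin n} (hi : i ∉ A) (h : I.Pinned A i) : i ∈ Q := by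
  by_contra hn
  obtain ⟨j, hj, h1, h2⟩ := h
  have hij : i ≠ j := fun h => hi (h ▸ hj)
  have hb : ∀ k, I.lo k ≤ I.val k ∧ I.val k ≤ I.hi k := fun k => ⟨I.lo_le_val k, I.val_le_hi k⟩
  have hc : ∀ k, I.lo k ≤ I.hi k := fun k => (hb k).1.trans (hb k).2
  have key := hQ.le_or_le hij
    (x := fun k => if k = i then I.hi k else I.val k)
    (y := fun k => if k = i then I.lo k else I.val k)
    (fun k => by split_ifs <;> simp [hb, hc])
    (fun k hk => if_neg (ne_of_mem_of_not_mem hk hn))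
    (fun k => by split_ifs <;> simp [hb, hc])
    (fun k hk => if_neg (ne_of_mem_of_not_mem hk hn))
  simp only [if_true, if_neg hij.symm] at key
  rcases key with k | k <;> linarith

theorem Input.Pinned.mono {I : Input n} {A B : Finset (Fin n)} (hAB : A ⊆ B) {i : Fin n}
    (h : I.Pinned A i) : I.Pinned B i := by
  obtain ⟨j, hj, h⟩ := h
  exact ⟨j, hAB hj, h⟩

theorem Input.dep_of_pinning {I : Input n} {i j : Fin n} (hij : i ≠ j)
    (h1 : I.lo i < I.val j - I.δ) (h2 : I.val j + I.δ < I.hi i) : I.Dep i j :=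
  ⟨hij, by linarith [I.lo_le_val j], by linarith [I.val_le_hi j]⟩

/-- Once no dependency is left, ordering the current intervals by their midpoints is correct. -/
theorem Input.Halted.solves {I : Input n} {s : State n} (h : I.Halted s) : I.Solves s.queried := by
  let m : Fin n → ℝ := fun i => I.curLo s i + I.curHi s i
  refine ⟨(Tuple.sort m).symm, fun x hx hxq i j hij => ?_⟩
  have hm := Tuple.monotone_sort m hij.le
  simp only [Function.comp_apply, Equiv.apply_symm_apply, m] at hm
  have hne : i ≠ j := fun h => hij.ne (by rw [h])
  have hc : ∀ k, I.curLo s k ≤ x k ∧ x k ≤ I.curHi s k := fun k => by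
    unfold Input.curLo Input.curHi
    split_ifs with hk
    · simp [hxq k hk]
    · exact hx k
  have hs := h i j
  simp only [Input.depGraph, not_and, not_lt] at hs
  by_cases h1 : I.δ < I.curHi s i - I.curLo s j
  · linarith [hs hne h1, (hc i).2, (hc j).1]
  · linarith [(hc i).2, (hc j).1]

/-! ### The structure of a random trial -/

open Classical in
/-- The dependent partners of `i` outside of `A`. For the set `A` of queried intervals these are the
neighbours of `i` in the dependency graph once all forced queries have been made. -/
def Input.openNbrs (I : Input n) (A : Finset (Fin n)) (i : Fin n) : Finset (Fin n) :=
  Finset.univ.filter fun j => j ∉ A ∧ I.Dep i j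

theorem Input.mem_openNbrs {I : Input n} {A : Finset (Fin n)} {i j : Fin n} :
    j ∈ I.openNbrs A i ↔ j ∉ A ∧ I.Dep i j := by
  simp [Input.openNbrs]

theorem Input.openNbrs_anti (I : Input n) {A B : Finset (Fin n)} (hAB : A ⊆ B) (i : Fin n) :
    I.openNbrs B i ⊆ I.openNbrs A i := fun j hj => by
  rw [Input.mem_openNbrs] at hj ⊢
  exact ⟨fun h => hj.1 (hAB h), hj.2⟩

/-- What the analysis uses about a random trial on `b` and `N`: the members of `N` are leaves
attached to `b`, and `b` has at most one further neighbour. -/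
structure Input.IsTrial (I : Input n) (A : Finset (Fin n)) (b : Fin n) (N : Finset (Fin n)) :
    Prop where
  center_notMem : b ∉ A
  nonempty : N.Nonempty
  subset : N ⊆ I.openNbrs A b
  leaf : ∀ j ∈ N, I.openNbrs A j ⊆ {b}
  rest : I.openNbrs A b ⊆ N ∨ ∃ c ∉ N, I.openNbrs A b = insert c N

theorem Input.isTrial_of_legal {I : Input n} {s : State n} {b : Fin n} {N : Finset (Fin n)}
    (h : I.Legal s (.trial b N)) : I.IsTrial s.queried b N := by
  obtain ⟨hF, -, h3, x, y, p, hp, hl, rfl, rfl⟩ := h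
  have hadj := I.depGraph_adj_iff s hF
  have hG := I.isAcyclic_depGraph s h3
  have h01 : (I.depGraph s).Adj x (p.getVert 1) := by
    simpa using p.adj_getVert_succ (i := 0) (by omega)
  have hb := ((hadj _ _).1 h01).2.1
  have hnb : ∀ j, (I.depGraph s).Adj (p.getVert 1) j ↔
      j ∈ I.openNbrs s.queried (p.getVert 1) := fun j => by
    rw [hadj, Input.mem_openNbrs]
    tauto
  have hx2 : x ≠ p.getVert 2 := by
    rcases hl.lt_or_eq with h | h
    · intro hx
      have := hp.1.getVert_injOn (x₁ := 0) (x₂ := 2) (by simp) (show 2 ≤ p.length by omega)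
        (by simpa using hx)
      omega
    · rw [p.getVert_of_length_le (by omega : p.length ≤ 2)]
      rw [p.getVert_of_length_le (by omega : p.length ≤ 1)] at h01
      exact h01.ne
  refine ⟨hb, ⟨x, ?_⟩, ?_, ?_, ?_⟩
  · simpa using ⟨h01.symm, hx2⟩
  · intro j hj
    simp only [Finset.mem_filter, Finset.mem_univ, true_and] at hj
    exact (hnb j).1 hj.1
  · intro j hj k hk
    simp only [Finset.mem_filter, Finset.mem_univ, true_and] at hj
    rw [Input.mem_openNbrs] at hk
    rw [Finset.mem_singleton]
    exact hp.eq_of_adj hG hl hj.1 hj.2 ((hadj _ _).2 ⟨((hadj _ _).1 hj.1).2.1, hk.1, hk.2⟩)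
  · by_cases hc : (I.depGraph s).Adj (p.getVert 1) (p.getVert 2)
    · refine .inr ⟨p.getVert 2, by simp, ?_⟩
      ext j
      simp only [← hnb, Finset.mem_insert, Finset.mem_filter, Finset.mem_univ, true_and]
      by_cases hj : j = p.getVert 2
      · simp [hj, hc]
      · simp [hj]
    · refine .inl fun j hj => ?_
      simp only [Finset.mem_filter, Finset.mem_univ, true_and]
      exact ⟨(hnb j).2 hj, fun h => hc (h ▸ (hnb j).2 hj)⟩

/-! ### The potential -/

open Classical in
/-- The multiple of its current cost that is set aside for the member `i` of an optimum query set
while the intervals in `A` are queried: a pinned interval is simply queried, an isolated one never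
needs to be, and a leaf of the dependency graph is cheaper to deal with than other vertices. -/
def Input.credit (I : Input n) (α β : ℝ) (A : Finset (Fin n)) (i : Fin n) : ℝ :=
  if I.Pinned A i then 1
  else if 2 ≤ (I.openNbrs A i).card then α
  else if (I.openNbrs A i).card = 1 then β
  else 0

/-- The coefficient of the current cost of `i` in the potential: the credit of `i` if it belongs to
the optimum query set `Q`, minus one. -/
def Input.rate (I : Input n) (α β : ℝ) (Q A : Finset (Fin n)) (i : Fin n) : ℝ :=
  if i ∈ A then 0 else (if i ∈ Q then I.credit α β A i else 0) - 1

/-- The query cost so far, plus the amounts by which the costs of intervals not yet queried were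
reduced, plus the credits of the members of `Q` not yet queried. The first two terms together are
the total cost of the input minus the current costs of the intervals not yet queried. -/
def Input.potential (I : Input n) (α β : ℝ) (Q : Finset (Fin n)) (s : State n) : ℝ :=
  ∑ i, I.cost i + ∑ i, I.rate α β Q s.queried i * s.cost i

section credit

variable {I : Input n} {α β : ℝ} {A B Q : Finset (Fin n)} {i : Fin n}

theorem Input.credit_nonneg (hβ : 1 ≤ β) (hαβ : β ≤ α) : 0 ≤ I.credit α β A i := by
  unfold Input.credit
  split_ifs <;> linarith

theorem Input.credit_le (hβ : 1 ≤ β) (hαβ : β ≤ α) : I.credit α β A i ≤ α := by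
  unfold Input.credit
  split_ifs <;> linarith

theorem Input.le_credit (hαβ : β ≤ α) (hp : ¬ I.Pinned A i) (h : (I.openNbrs A i).Nonempty) :
    β ≤ I.credit α β A i := by
  have := h.card_pos
  unfold Input.credit
  split_ifs
  · exact hαβ
  · exact le_rfl
  · omega

theorem Input.credit_le_of_card_le_one (hβ : 1 ≤ β) (h : (I.openNbrs A i).card ≤ 1) :
    I.credit α β A i ≤ β := by
  unfold Input.credit
  split_ifs
  · exact hβ
  · omega
  · exact le_rfl
  · linarith

theorem Input.credit_le_one_of_openNbrs_eq_empty (h : I.openNbrs A i = ∅) :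
    I.credit α β A i ≤ 1 := by
  unfold Input.credit
  split_ifs <;> simp_all

/-- Credits only decrease, as an interval can only become pinned by one of its neighbours. -/
theorem Input.credit_anti (hβ : 1 ≤ β) (hαβ : β ≤ α) (hAB : A ⊆ B) (hi : i ∉ B) :
    I.credit α β B i ≤ I.credit α β A i := by
  by_cases hA : I.Pinned A i
  · simp [Input.credit, hA, hA.mono hAB]
  by_cases hB : I.Pinned B i
  · have h1 : I.credit α β B i = 1 := if_pos hB
    obtain ⟨j, hj, hl, hr⟩ := hB
    have hjA : j ∉ A := fun h => hA ⟨j, h, hl, hr⟩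
    have hij : i ≠ j := fun h => hi (h ▸ hj)
    have := Input.le_credit hαβ hA ⟨j, Input.mem_openNbrs.2 ⟨hjA, Input.dep_of_pinning hij hl hr⟩⟩
    linarith
  · have hc := Finset.card_le_card (I.openNbrs_anti hAB i)
    simp only [Input.credit, hA, hB, if_false]
    split_ifs <;> first | omega | linarith

theorem Input.rate_of_mem (h : i ∈ A) : I.rate α β Q A i = 0 := if_pos h

theorem Input.rate_of_mem_opt (h : i ∉ A) (hQ : i ∈ Q) :
    I.rate α β Q A i = I.credit α β A i - 1 := by
  simp [Input.rate, h, hQ]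

theorem Input.rate_of_notMem_opt (h : i ∉ A) (hQ : i ∉ Q) : I.rate α β Q A i = -1 := by
  simp [Input.rate, h, hQ]

theorem Input.neg_one_le_rate (hβ : 1 ≤ β) (hαβ : β ≤ α) : -1 ≤ I.rate α β Q A i := by
  have := I.credit_nonneg (A := A) (i := i) hβ hαβ
  unfold Input.rate
  split_ifs <;> linarith

theorem Input.rate_anti (hβ : 1 ≤ β) (hαβ : β ≤ α) (hAB : A ⊆ B) (hi : i ∈ B → i ∈ A) :
    I.rate α β Q B i ≤ I.rate α β Q A i := by
  by_cases hB : i ∈ B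
  · rw [Input.rate_of_mem hB, Input.rate_of_mem (hi hB)]
  have hA : i ∉ A := fun h => hB (hAB h)
  have := I.credit_anti hβ hαβ hAB hB
  simp only [Input.rate, hA, hB, if_false]
  split_ifs <;> linarith

end credit

section potential

variable {I : Input n} {α β : ℝ} {Q : Finset (Fin n)}

theorem Input.potential_initial_le (hβ : 1 ≤ β) (hαβ : β ≤ α) :
    I.potential α β Q I.initial ≤ α * I.queryCost Q := by
  simp only [Input.potential, Input.initial, Input.queryCost, Finset.mul_sum]
  rw [← Finset.sum_add_distrib, ← Finset.sum_filter_add_sum_filter_not Finset.univ (· ∈ Q)]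
  have h1 : ∑ i with i ∉ Q, (I.cost i + I.rate α β Q ∅ i * I.cost i) = 0 :=
    Finset.sum_eq_zero fun i hi => by
      rw [Input.rate_of_notMem_opt (Finset.notMem_empty i) (Finset.mem_filter.1 hi).2]
      ring
  rw [h1, add_zero, Finset.filter_univ_mem]
  refine Finset.sum_le_sum fun i hi => ?_
  rw [Input.rate_of_mem_opt (Finset.notMem_empty i) hi]
  have := mul_le_mul_of_nonneg_right (I.credit_le (A := ∅) (i := i) hβ hαβ) (I.cost_nonneg i)
  linarith

theorem Input.queryCost_le_potential (hβ : 1 ≤ β) (hαβ : β ≤ α) {s : State n}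
    (h0 : ∀ i, 0 ≤ s.cost i) (h1 : ∀ i, s.cost i ≤ I.cost i) :
    I.queryCost s.queried ≤ I.potential α β Q s := by
  simp only [Input.potential, Input.queryCost]
  rw [← Finset.sum_add_distrib, ← Finset.sum_filter_add_sum_filter_not Finset.univ (· ∈ s.queried),
    Finset.filter_univ_mem]
  have h2 : 0 ≤ ∑ i with i ∉ s.queried,
      (I.cost i + I.rate α β Q s.queried i * s.cost i) := Finset.sum_nonneg fun i _ => by
    have := mul_le_mul_of_nonneg_right (I.neg_one_le_rate (Q := Q) (A := s.queried) (i := i) hβ hαβ)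
      (h0 i)
    linarith [h1 i]
  have h3 : ∑ i ∈ s.queried, (I.cost i + I.rate α β Q s.queried i * s.cost i) =
      ∑ i ∈ s.queried, I.cost i := Finset.sum_congr rfl fun i hi => by
    rw [Input.rate_of_mem hi, zero_mul, add_zero]
  linarith

/-! ### The potential does not increase in expectation -/

/-- Querying an interval whose credit covers its cost. -/
theorem Input.potential_insert_le (hβ : 1 ≤ β) (hαβ : β ≤ α) {s : State n}
    (h0 : ∀ i, 0 ≤ s.cost i) {i : Fin n} (hi : 0 ≤ I.rate α β Q s.queried i * s.cost i) :
    I.potential α β Q ⟨insert i s.queried, s.cost⟩ ≤ I.potential α β Q s := by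
  refine add_le_add_right (Finset.sum_le_sum fun k _ => ?_) _
  dsimp only
  rcases eq_or_ne k i with rfl | hk
  · rwa [Input.rate_of_mem (Finset.mem_insert_self _ _), zero_mul]
  · exact mul_le_mul_of_nonneg_right (Input.rate_anti hβ hαβ (Finset.subset_insert _ _)
      fun h => Finset.mem_of_mem_insert_of_ne h hk) (h0 k)

/-- A solution contains two of the three vertices of a triangle, all of degree at least two, so the
reduction of the costs frees credits of `2 * α ≥ 3` times the amount subtracted. -/
theorem Input.potential_triangle_le (hQ : I.Solves Q) (hα : 3 / 2 ≤ α) {s : State n}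
    (hF : ∀ k, ¬ I.Forced s k) {a b c : Fin n}
    (hab : (I.depGraph s).Adj a b) (hbc : (I.depGraph s).Adj b c) (hac : (I.depGraph s).Adj a c)
    {m : ℝ} (hm : 0 ≤ m) :
    I.potential α β Q ⟨s.queried, fun j =>
      if j = a ∨ j = b ∨ j = c then s.cost j - m else s.cost j⟩ ≤ I.potential α β Q s := by
  have hne1 := hab.ne
  have hne2 := hbc.ne
  have hne3 := hac.ne
  rw [I.depGraph_adj_iff s hF] at hab hbc hac
  obtain ⟨ha, hb, hab⟩ := hab
  obtain ⟨-, hc, hbc⟩ := hbc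
  replace hac := hac.2.2
  have key : ∀ x y z, x ∉ s.queried → y ∉ s.queried → z ∉ s.queried → y ≠ z → I.Dep x y →
      I.Dep x z → I.rate α β Q s.queried x = if x ∈ Q then α - 1 else -1 := by
    intro x y z hx hy hz hyz hxy hxz
    have h2 : 2 ≤ (I.openNbrs s.queried x).card := by
      rw [← Finset.card_pair hyz]
      refine Finset.card_le_card fun w hw => ?_
      rcases Finset.mem_insert.1 hw with rfl | hw
      · exact Input.mem_openNbrs.2 ⟨hy, hxy⟩
      · rw [Finset.mem_singleton.1 hw]
        exact Input.mem_openNbrs.2 ⟨hz, hxz⟩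
    have hp : ¬ I.Pinned s.queried x := fun h => hF x ⟨hx, h⟩
    split_ifs with hxQ
    · rw [Input.rate_of_mem_opt hx hxQ, Input.credit, if_neg hp, if_pos h2]
    · exact Input.rate_of_notMem_opt hx hxQ
  have ra := key a b c ha hb hc hne2 hab hac
  have rb := key b a c hb ha hc hne3 hab.symm hbc
  have rc := key c a b hc ha hb hne1 hac.symm hbc.symm
  have hsum : 0 ≤ I.rate α β Q s.queried a + I.rate α β Q s.queried b +
      I.rate α β Q s.queried c := by
    have q1 := hQ.mem_or_mem hab
    have q2 := hQ.mem_or_mem hbc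
    have q3 := hQ.mem_or_mem hac
    rw [ra, rb, rc]
    split_ifs <;> first | linarith | (exfalso; tauto)
  have hsplit : ∀ k, I.rate α β Q s.queried k *
      (if k = a ∨ k = b ∨ k = c then s.cost k - m else s.cost k) =
      I.rate α β Q s.queried k * s.cost k -
        m * (if k ∈ ({a, b, c} : Finset (Fin n)) then I.rate α β Q s.queried k else 0) := by
    intro k
    simp only [Finset.mem_insert, Finset.mem_singleton]
    split_ifs <;> ring
  refine add_le_add_right ?_ _
  simp only [hsplit, Finset.sum_sub_distrib, ← Finset.mul_sum, Finset.sum_ite_mem,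
    Finset.univ_inter]
  rw [Finset.sum_insert (by simp [hne1, hne3]), Finset.sum_insert (by simp [hne2]),
    Finset.sum_singleton]
  linarith [mul_nonneg hm hsum]

/-- The conditions on the parameter `τ` of the trial probability and the ratio `α` under which the
analysis goes through. -/
structure IsAdmissible (τ α : ℝ) : Prop where
  pos : 0 < τ
  le_two : τ ≤ 2
  bound : ∀ p : ℝ, 0 ≤ p → p ≤ 1 → (1 - p) * (τ * p + 1 / τ) ≤ α - 1

namespace IsAdmissible

variable {τ : ℝ}

theorem half_le (h : IsAdmissible τ α) : 1 / 2 ≤ 1 / τ := one_div_le_one_div_of_le h.pos h.le_two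

theorem leafCredit_le (h : IsAdmissible τ α) : 1 + 1 / τ ≤ α := by
  have := h.bound 0 le_rfl zero_le_one
  simp only [sub_zero, mul_zero, zero_add, one_mul] at this
  linarith

/-- If the optimum does not query the center of a trial, it queries all leaves, and the expected
cost of querying the center is charged to them. If it queries the center, then the latter pays for
the leaves that the optimum does not query, and keeps the credit of a leaf in case the trial fails;
this is the case that determines the ratio. -/
theorem potential_trial_le (h : IsAdmissible τ α) (hQ : I.Solves Q) {s : State n}
    (hF : ∀ k, ¬ I.Forced s k) (h0 : ∀ i, 0 ≤ s.cost i) {b : Fin n} {N : Finset (Fin n)}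
    (ht : I.IsTrial s.queried b N) (hB : s.cost b ≠ 0) {p : ℝ} (hp : p = min 1 ((∑ j ∈ N, s.cost j) / (τ * s.cost b))) :
    p * I.potential α (1 + 1 / τ) Q ⟨insert b s.queried, s.cost⟩ +
      (1 - p) * I.potential α (1 + 1 / τ) Q ⟨s.queried ∪ N, s.cost⟩ ≤
      I.potential α (1 + 1 / τ) Q s := by
  have hτ := h.pos
  have hτi : 0 < 1 / τ := one_div_pos.2 hτ
  have hβ : 1 ≤ 1 + 1 / τ := by linarith
  have hαβ := h.leafCredit_le
  have hB' : 0 < s.cost b := lt_of_le_of_ne (h0 b) hB.symm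
  set A := s.queried
  set W := ∑ j ∈ N, s.cost j with hW
  set B := s.cost b
  have hW0 : 0 ≤ W := Finset.sum_nonneg fun j _ => h0 j
  have hp0 : 0 ≤ p := by rw [hp]; positivity
  have hp1 : p ≤ 1 := hp ▸ min_le_left _ _
  have hpB : p * B ≤ 1 / τ * W := by
    have : p ≤ W / (τ * B) := hp ▸ min_le_right _ _
    calc p * B ≤ W / (τ * B) * B := mul_le_mul_of_nonneg_right this hB'.le
      _ = 1 / τ * W := by field_simp
  -- If `p = 1`, both sides vanish; otherwise `p` is the quotient.
  have hpW : (1 - p) * W = (1 - p) * (τ * p * B) := by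
    rcases le_total 1 (W / (τ * B)) with hle | hle
    · rw [hp, min_eq_left hle]
      ring
    · have : W = τ * p * B := by
        rw [hp, min_eq_right hle]
        field_simp
      rw [← this]
  have hbA := ht.center_notMem
  have hN : ∀ j ∈ N, j ∉ A ∧ I.Dep b j := fun j hj => Input.mem_openNbrs.1 (ht.subset hj)
  have hbN : b ∉ N := fun hb => (hN b hb).2.1 rfl
  have hnp : ∀ k ∉ A, ¬ I.Pinned A k := fun k hk hpk => hF k ⟨hk, hpk⟩
  -- The expected decrease of the term of `k` in the potential.
  let r : Finset (Fin n) → Fin n → ℝ := I.rate α (1 + 1 / τ) Q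
  let D : Fin n → ℝ := fun k =>
    r A k * s.cost k - p * (r (insert b A) k * s.cost k) - (1 - p) * (r (A ∪ N) k * s.cost k)
  suffices hD : 0 ≤ ∑ k, D k by
    simp only [D, r, Finset.sum_sub_distrib, ← Finset.mul_sum] at hD
    simp only [Input.potential]
    linarith
  have hother : 0 ≤ ∑ k ∈ (insert b N)ᶜ, D k := by
    refine Finset.sum_nonneg fun k hk => ?_
    simp only [Finset.mem_compl, Finset.mem_insert, not_or] at hk
    have r1 : r (insert b A) k ≤ r A k := Input.rate_anti hβ hαβ (Finset.subset_insert _ _)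
      fun hm => Finset.mem_of_mem_insert_of_ne hm hk.1
    have r2 : r (A ∪ N) k ≤ r A k := Input.rate_anti hβ hαβ Finset.subset_union_left
      fun hm => (Finset.mem_union.1 hm).resolve_right hk.2
    have e1 := mul_le_mul_of_nonneg_left (mul_le_mul_of_nonneg_right r1 (h0 k)) hp0
    have e2 := mul_le_mul_of_nonneg_left (mul_le_mul_of_nonneg_right r2 (h0 k)) (sub_nonneg.2 hp1)
    simp only [D]
    linarith
  rw [← Finset.sum_add_sum_compl (insert b N), Finset.sum_insert hbN]
  have hDb : D b = (r A b - (1 - p) * r (A ∪ N) b) * B := by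
    simp only [D, r, Input.rate_of_mem (Finset.mem_insert_self b A)]
    ring
  have hDN : ∀ j ∈ N, D j = (r A j - p * r (insert b A) j) * s.cost j := fun j hj => by
    simp only [D, r, Input.rate_of_mem (Finset.mem_union_right A hj)]
    ring
  -- Once `b` is queried, a leaf is either pinned or isolated.
  have hleaf : ∀ j ∈ N, j ∈ Q → 1 / τ ≤ r A j ∧ r (insert b A) j ≤ 0 := by
    intro j hj hjQ
    have hjA := (hN j hj).1
    have hjb : j ∉ insert b A := by
      rw [Finset.mem_insert, not_or]
      exact ⟨(hN j hj).2.1.symm, hjA⟩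
    simp only [r, Input.rate_of_mem_opt hjA hjQ, Input.rate_of_mem_opt hjb hjQ]
    have c1 := Input.le_credit hαβ (hnp j hjA)
      ⟨b, Input.mem_openNbrs.2 ⟨hbA, (hN j hj).2.symm⟩⟩
    have c2 := Input.credit_le_one_of_openNbrs_eq_empty (α := α) (β := 1 + 1 / τ) (I := I)
      (A := insert b A) (i := j) (Finset.eq_empty_of_forall_notMem fun k hk => by
        have hkb := Finset.mem_singleton.1
          (ht.leaf j hj (I.openNbrs_anti (Finset.subset_insert b A) j hk))
        exact (Input.mem_openNbrs.1 hk).1 (hkb ▸ Finset.mem_insert_self b A))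
    constructor <;> linarith
  by_cases hbQ : b ∈ Q
  · have hsumN : -((1 - p) * W) ≤ ∑ j ∈ N, D j := by
      rw [hW, Finset.mul_sum, ← Finset.sum_neg_distrib]
      refine Finset.sum_le_sum fun j hj => ?_
      rw [hDN j hj, ← neg_mul]
      refine mul_le_mul_of_nonneg_right ?_ (h0 j)
      by_cases hjQ : j ∈ Q
      · obtain ⟨l1, l2⟩ := hleaf j hj hjQ
        nlinarith
      · have hjA := (hN j hj).1
        have hjb : j ∉ insert b A := by
          rw [Finset.mem_insert, not_or]
          exact ⟨(hN j hj).2.1.symm, hjA⟩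
        simp only [r, Input.rate_of_notMem_opt hjA hjQ, Input.rate_of_notMem_opt hjb hjQ]
        linarith
    have hbAN : b ∉ A ∪ N := by simp [hbA, hbN]
    have hnb : ∀ k, k ∈ I.openNbrs (A ∪ N) b → k ∈ I.openNbrs A b ∧ k ∉ N := fun k hk =>
      ⟨I.openNbrs_anti Finset.subset_union_left b hk,
        fun hkN => (Input.mem_openNbrs.1 hk).1 (Finset.mem_union_right A hkN)⟩
    have hDb' : (1 - p) * W ≤ D b := by
      rw [hDb, hpW]
      simp only [r, Input.rate_of_mem_opt hbA hbQ, Input.rate_of_mem_opt hbAN hbQ]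
      rw [← mul_assoc]
      refine mul_le_mul_of_nonneg_right ?_ hB'.le
      rcases ht.rest with hr | ⟨c, hcN, hr⟩
      · -- A failed trial isolates `b`.
        have c1 := Input.le_credit hαβ (hnp b hbA) (ht.nonempty.mono ht.subset)
        have c2 := Input.credit_le_one_of_openNbrs_eq_empty (α := α) (β := 1 + 1 / τ) (I := I)
          (A := A ∪ N) (i := b) (Finset.eq_empty_of_forall_notMem fun k hk =>
            (hnb k hk).2 (hr (hnb k hk).1))
        have c3 : (1 - p) * (τ * p) ≤ τ / 4 := by nlinarith [mul_nonneg hτ.le (sq_nonneg (p - 1/2))]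
        have c4 : τ / 4 ≤ 1 / τ := by linarith [h.le_two, h.half_le]
        nlinarith
      · -- A failed trial turns `b` into a leaf attached to `c`.
        have h2 : 2 ≤ (I.openNbrs A b).card := by
          rw [hr, Finset.card_insert_of_notMem hcN]
          have := ht.nonempty.card_pos
          omega
        have c1 : I.credit α (1 + 1 / τ) A b = α := by
          rw [Input.credit, if_neg (hnp b hbA), if_pos h2]
        have c2 := Input.credit_le_of_card_le_one (α := α) (I := I) (A := A ∪ N) (i := b) hβ
          (by
            rw [← Finset.card_singleton c]
            refine Finset.card_le_card fun k hk => Finset.mem_singleton.2 ?_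
            have hk' := hnb k hk
            rw [hr] at hk'
            exact (Finset.mem_insert.1 hk'.1).resolve_right hk'.2)
        have c3 := h.bound p hp0 hp1
        rw [c1]
        nlinarith
    linarith
  · have hsumN : 1 / τ * W ≤ ∑ j ∈ N, D j := by
      rw [hW, Finset.mul_sum]
      refine Finset.sum_le_sum fun j hj => ?_
      rw [hDN j hj]
      refine mul_le_mul_of_nonneg_right ?_ (h0 j)
      obtain ⟨l1, l2⟩ := hleaf j hj ((hQ.mem_or_mem (hN j hj).2).resolve_left hbQ)
      nlinarith
    have hbAN : b ∉ A ∪ N := by simp [hbA, hbN]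
    have hDb' : D b = -(p * B) := by
      rw [hDb]
      simp only [r, Input.rate_of_notMem_opt hbA hbQ, Input.rate_of_notMem_opt hbAN hbQ]
      ring
    linarith

end IsAdmissible

end potential

/-! ### Expectations of discrete distributions -/

/-- The expectation of a nonnegative function under a discrete distribution. -/
def expect {X : Type*} (p : PMF X) (f : X → ENNReal) : ENNReal := ∑' x, p x * f x

theorem expect_pure {X : Type*} (x : X) (f : X → ENNReal) : expect (PMF.pure x) f = f x := by
  rw [expect, tsum_eq_single x fun y hy => by rw [PMF.pure_apply_of_ne _ _ hy, zero_mul],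
    PMF.pure_apply_self, one_mul]

theorem expect_bind {X Y : Type*} (p : PMF X) (q : X → PMF Y) (f : Y → ENNReal) :
    expect (p.bind q) f = expect p fun x => expect (q x) f := by
  simp only [expect, PMF.bind_apply, ← ENNReal.tsum_mul_right, ← ENNReal.tsum_mul_left]
  rw [ENNReal.tsum_comm]
  simp only [mul_assoc]

theorem expect_map {X Y : Type*} (p : PMF X) (g : X → Y) (f : Y → ENNReal) :
    expect (p.map g) f = expect p (f ∘ g) := by
  rw [← PMF.bind_pure_comp, expect_bind]
  simp only [Function.comp_apply, expect_pure]
  rfl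

theorem expect_mono {X : Type*} {p : PMF X} {f g : X → ENNReal}
    (h : ∀ x ∈ p.support, f x ≤ g x) : expect p f ≤ expect p g := by
  refine ENNReal.tsum_le_tsum fun x => ?_
  by_cases hx : x ∈ p.support
  · exact mul_le_mul_right (h x hx) _
  · rw [(PMF.apply_eq_zero_iff p x).2 hx, zero_mul, zero_mul]

theorem expect_biasedCoin_map {X : Type*} (p : NNReal) (hp : p ≤ 1) {x y : X} {f : X → ℝ}
    (hx : 0 ≤ f x) (hy : 0 ≤ f y) :
    expect ((biasedCoin p hp).map fun c => if c then x else y) (fun z => ENNReal.ofReal (f z)) =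
      ENNReal.ofReal (p * f x + (1 - p) * f y) := by
  have hp' : (0 : ℝ) ≤ 1 - p := sub_nonneg.2 (by exact_mod_cast hp)
  rw [expect_map, expect, tsum_fintype, Fintype.sum_bool,
    ENNReal.ofReal_add (mul_nonneg p.coe_nonneg hx) (mul_nonneg hp' hy), ENNReal.ofReal_mul p.coe_nonneg,
    ENNReal.ofReal_mul hp']
  have h1 : ENNReal.ofReal (1 - p) = ((1 - p : NNReal) : ENNReal) := by
    rw [ENNReal.ofReal, ← NNReal.coe_one, ← NNReal.coe_sub hp, Real.toNNReal_coe]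
  rw [h1, ENNReal.ofReal_coe_nnreal]
  simp [biasedCoin]

/-! ### One step of the algorithm -/

/-- The current costs are nonnegative and at most the original ones. -/
def Input.CostsValid (I : Input n) (s : State n) : Prop :=
  ∀ i, 0 ≤ s.cost i ∧ s.cost i ≤ I.cost i

theorem Input.CostsValid.mem_support {I : Input n} {s s' : State n} (h : I.CostsValid s) {τ : ℝ}
    {m : Move n} (hs' : s' ∈ (applyMove τ s m).support) : I.CostsValid s' := by
  intro i
  cases m with
  | forced j =>
    rw [applyMove, PMF.mem_support_pure_iff] at hs'
    subst hs'
    exact h i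
  | zeroCost j =>
    rw [applyMove, PMF.mem_support_pure_iff] at hs'
    subst hs'
    exact h i
  | triangle a b c =>
    rw [applyMove, PMF.mem_support_pure_iff] at hs'
    subst hs'
    have hm : 0 ≤ min (s.cost a) (min (s.cost b) (s.cost c)) :=
      le_min (h a).1 (le_min (h b).1 (h c).1)
    dsimp only
    split_ifs with hi
    · refine ⟨sub_nonneg.2 ?_, by linarith [(h i).2]⟩
      rcases hi with rfl | rfl | rfl <;> simp
    · exact h i
  | trial b N =>
    rw [applyMove, PMF.mem_support_map_iff] at hs'
    obtain ⟨c, -, rfl⟩ := hs'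
    cases c <;> exact h i

open Classical in
/-- The number of intervals not yet queried plus the number of those among them that have a nonzero
current cost. It bounds the number of remaining steps. -/
def State.remaining (s : State n) : ℕ :=
  s.queriedᶜ.card + (s.queriedᶜ.filter fun i => s.cost i ≠ 0).card

theorem State.remaining_initial_le (I : Input n) : I.initial.remaining ≤ 2 * n := by
  have h1 := Finset.card_le_univ (I.initial.queriedᶜ)
  have h2 := Finset.card_filter_le (I.initial.queriedᶜ) fun i => I.initial.cost i ≠ 0
  rw [Fintype.card_fin] at h1
  unfold State.remaining
  convert (by omega : I.initial.queriedᶜ.card +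
    (I.initial.queriedᶜ.filter fun i => I.initial.cost i ≠ 0).card ≤ 2 * n)

theorem State.remaining_lt_of_queried {s : State n} {A : Finset (Fin n)} (hA : s.queried ⊆ A)
    {i : Fin n} (hi : i ∉ s.queried) (hiA : i ∈ A) :
    State.remaining ⟨A, s.cost⟩ < s.remaining := by
  have hss : Aᶜ ⊂ s.queriedᶜ := Finset.compl_ssubset_compl.2
    ⟨hA, fun h => hi (h hiA)⟩
  exact add_lt_add_of_lt_of_le (Finset.card_lt_card hss)
    (Finset.card_le_card (Finset.filter_subset_filter _ hss.1))

theorem Input.remaining_lt {I : Input n} {s s' : State n} {τ : ℝ} {m : Move n}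
    (hm : I.Legal s m) (hs' : s' ∈ (applyMove τ s m).support) : s'.remaining < s.remaining := by
  cases m with
  | forced i =>
    rw [applyMove, PMF.mem_support_pure_iff] at hs'
    subst hs'
    exact State.remaining_lt_of_queried (Finset.subset_insert _ _) hm.1
      (Finset.mem_insert_self _ _)
  | zeroCost i =>
    rw [applyMove, PMF.mem_support_pure_iff] at hs'
    subst hs'
    exact State.remaining_lt_of_queried (Finset.subset_insert _ _) hm.2.1
      (Finset.mem_insert_self _ _)
  | triangle a b c =>
    rw [applyMove, PMF.mem_support_pure_iff] at hs'
    subst hs'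
    obtain ⟨hF, hne, hab, hbc, -⟩ := hm
    have ha := ((I.depGraph_adj_iff s hF _ _).1 hab).1
    obtain ⟨hb, hc, -⟩ := (I.depGraph_adj_iff s hF _ _).1 hbc
    set μ := min (s.cost a) (min (s.cost b) (s.cost c))
    obtain ⟨x, hx, hxA, hxμ⟩ : ∃ x, (x = a ∨ x = b ∨ x = c) ∧ x ∉ s.queried ∧ s.cost x = μ := by
      rcases min_choice (s.cost a) (min (s.cost b) (s.cost c)) with h | h
      · exact ⟨a, by simp, ha, h.symm⟩
      rcases min_choice (s.cost b) (s.cost c) with h' | h'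
      · exact ⟨b, by simp, hb, (h.trans h').symm⟩
      · exact ⟨c, by simp, hc, (h.trans h').symm⟩
    refine Nat.add_lt_add_left (Finset.card_lt_card ?_) _
    refine ⟨fun k hk => ?_, fun hsub => ?_⟩
    · rw [Finset.mem_filter] at hk ⊢
      exact ⟨hk.1, hne k (Finset.mem_compl.1 hk.1)⟩
    · have hx' := hsub (Finset.mem_filter.2 ⟨Finset.mem_compl.2 hxA, hne x hxA⟩)
      rw [Finset.mem_filter] at hx'
      exact hx'.2 ((if_pos hx).trans (by rw [hxμ, sub_self]))
  | trial b N =>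
    have ht := Input.isTrial_of_legal hm
    rw [applyMove, PMF.mem_support_map_iff] at hs'
    obtain ⟨c, -, rfl⟩ := hs'
    cases c with
    | true =>
      exact State.remaining_lt_of_queried (Finset.subset_insert _ _) ht.center_notMem
        (Finset.mem_insert_self _ _)
    | false =>
      obtain ⟨j, hj⟩ := ht.nonempty
      exact State.remaining_lt_of_queried Finset.subset_union_left
        (Input.mem_openNbrs.1 (ht.subset hj)).1 (Finset.mem_union_right _ hj)

theorem IsAdmissible.expect_applyMove_le {τ α : ℝ} (h : IsAdmissible τ α) {I : Input n}
    {Q : Finset (Fin n)} (hQ : I.Solves Q) {s : State n} (hs : I.CostsValid s) {m : Move n}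
    (hm : I.Legal s m) :
    expect (applyMove τ s m) (fun s' => ENNReal.ofReal (I.potential α (1 + 1 / τ) Q s')) ≤
      ENNReal.ofReal (I.potential α (1 + 1 / τ) Q s) := by
  have hβ : 1 ≤ 1 + 1 / τ := by linarith [h.half_le]
  have hαβ := h.leafCredit_le
  have h0 : ∀ i, 0 ≤ s.cost i := fun i => (hs i).1
  cases m with
  | forced i =>
    rw [applyMove, expect_pure]
    refine ENNReal.ofReal_le_ofReal (Input.potential_insert_le hβ hαβ h0 ?_)
    have hp : I.Pinned s.queried i := hm.2
    rw [Input.rate_of_mem_opt hm.1 (hQ.mem_of_pinned hm.1 hp), Input.credit, if_pos hp, sub_self,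
      zero_mul]
  | zeroCost i =>
    rw [applyMove, expect_pure]
    refine ENNReal.ofReal_le_ofReal (Input.potential_insert_le hβ hαβ h0 ?_)
    rw [hm.2.2, mul_zero]
  | triangle a b c =>
    rw [applyMove, expect_pure]
    exact ENNReal.ofReal_le_ofReal (Input.potential_triangle_le hQ (by linarith [h.half_le]) hm.1
      hm.2.2.1 hm.2.2.2.1 hm.2.2.2.2 (le_min (h0 a) (le_min (h0 b) (h0 c))))
  | trial b N =>
    have ht := Input.isTrial_of_legal hm
    have hnonneg : ∀ A, 0 ≤ I.potential α (1 + 1 / τ) Q ⟨A, s.cost⟩ := fun A =>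
      (Finset.sum_nonneg fun i _ => I.cost_nonneg i).trans
        (Input.queryCost_le_potential hβ hαβ (s := ⟨A, s.cost⟩) h0 fun i => (hs i).2)
    rw [applyMove, expect_biasedCoin_map _ _ (hnonneg _) (hnonneg _)]
    refine ENNReal.ofReal_le_ofReal (h.potential_trial_le hQ hm.1 h0 ht
      (hm.2.1 b ht.center_notMem) (Real.coe_toNNReal _ ?_))
    exact le_min zero_le_one (div_nonneg (Finset.sum_nonneg fun j _ => h0 j)
      (mul_nonneg h.pos.le (h0 b)))

/-! ### The whole run -/

theorem mem_support_step {I : Input n} {τ : ℝ} {σ : Rule I} {c c' : State n × List (State n)}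
    (h : c' ∈ (step I τ σ c).support) (hc : ¬ I.Halted c.1) :
    ∃ m, I.Legal c.1 m ∧ c'.1 ∈ (applyMove τ c.1 m).support := by
  rw [step, dif_neg hc, PMF.mem_support_map_iff] at h
  obtain ⟨s, hs, rfl⟩ := h
  exact ⟨_, σ.legal _ _ hc, hs⟩

theorem mem_support_run {I : Input n} {τ : ℝ} {σ : Rule I} {t : ℕ}
    {c : State n × List (State n)} (h : c ∈ (run I τ σ t).support) :
    I.CostsValid c.1 ∧ (I.Halted c.1 ∨ c.1.remaining + t ≤ 2 * n) := by
  induction t generalizing c with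
  | zero =>
    rw [run, PMF.mem_support_pure_iff] at h
    subst h
    exact ⟨fun i => ⟨I.cost_nonneg i, le_rfl⟩, .inr (State.remaining_initial_le I)⟩
  | succ t ih =>
    rw [run, PMF.mem_support_bind_iff] at h
    obtain ⟨c₀, h₀, h⟩ := h
    obtain ⟨hv, hr⟩ := ih h₀
    by_cases hc : I.Halted c₀.1
    · rw [step, dif_pos hc, PMF.mem_support_pure_iff] at h
      subst h
      exact ⟨hv, .inl hc⟩
    · obtain ⟨m, hm, hs⟩ := mem_support_step h hc
      have h1 := Input.remaining_lt hm hs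
      have h2 := hr.resolve_left hc
      exact ⟨hv.mem_support hs, .inr (by omega)⟩

theorem IsAdmissible.expect_run_le {τ α : ℝ} (h : IsAdmissible τ α) {I : Input n} (σ : Rule I)
    {Q : Finset (Fin n)} (hQ : I.Solves Q) (t : ℕ) :
    expect (run I τ σ t) (fun c => ENNReal.ofReal (I.potential α (1 + 1 / τ) Q c.1)) ≤
      ENNReal.ofReal (I.potential α (1 + 1 / τ) Q I.initial) := by
  induction t with
  | zero => rw [run, expect_pure]
  | succ t ih =>
    rw [run, expect_bind]
    refine (expect_mono fun c hc => ?_).trans ih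
    by_cases hh : I.Halted c.1
    · rw [step, dif_pos hh, expect_pure]
    · rw [step, dif_neg hh, expect_map]
      exact h.expect_applyMove_le hQ (mem_support_run hc).1 (σ.legal _ _ hh)

theorem ofReal_expectedCost (I : Input n) (τ : ℝ) (σ : Rule I) (t : ℕ) :
    ENNReal.ofReal (expectedCost I τ σ t) =
      expect (run I τ σ t) fun c => ENNReal.ofReal (I.queryCost c.1.queried) := by
  have h0 : ∀ S, 0 ≤ I.queryCost S := fun S => Finset.sum_nonneg fun i _ => I.cost_nonneg i
  have h1 : expect (queriedAfter I τ σ t) (fun S => ENNReal.ofReal (I.queryCost S)) =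
      expect (run I τ σ t) fun c => ENNReal.ofReal (I.queryCost c.1.queried) :=
    expect_map _ _ _
  rw [← h1, expect, tsum_fintype, expectedCost,
    ENNReal.ofReal_sum_of_nonneg fun S _ => mul_nonneg ENNReal.toReal_nonneg (h0 S)]
  refine Finset.sum_congr rfl fun S _ => ?_
  rw [ENNReal.ofReal_mul ENNReal.toReal_nonneg, ENNReal.ofReal_toReal (PMF.apply_ne_top _ _)]

theorem IsAdmissible.hasExpectedRatio {τ α : ℝ} (h : IsAdmissible τ α) :
    HasExpectedRatio τ α := by
  classical
  intro n I σ
  have hβ : 1 ≤ 1 + 1 / τ := by linarith [h.half_le]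
  have hαβ := h.leafCredit_le
  refine ⟨2 * n + 1, fun c hc => ?_, ?_⟩
  · have hh : I.Halted c.1 := (mem_support_run hc).2.resolve_right (by omega)
    exact ⟨hh, hh.solves⟩
  · obtain ⟨Q, hQ, hopt⟩ := Finset.exists_mem_eq_inf' I.filter_solves_nonempty I.queryCost
    replace hQ : I.Solves Q := (Finset.mem_filter.1 hQ).2
    replace hopt : I.optCost = I.queryCost Q := by
      rw [← hopt, Input.optCost]
    have hopt0 : 0 ≤ α * I.queryCost Q :=
      mul_nonneg (by linarith) (Finset.sum_nonneg fun i _ => I.cost_nonneg i)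
    rw [hopt, ← ENNReal.ofReal_le_ofReal_iff hopt0, ofReal_expectedCost]
    calc _ ≤ expect (run I τ σ (2 * n + 1)) (fun c =>
          ENNReal.ofReal (I.potential α (1 + 1 / τ) Q c.1)) :=
          expect_mono fun c hc => ENNReal.ofReal_le_ofReal <|
            Input.queryCost_le_potential hβ hαβ (fun i => ((mem_support_run hc).1 i).1)
              fun i => ((mem_support_run hc).1 i).2
      _ ≤ _ := h.expect_run_le σ hQ _
      _ ≤ _ := ENNReal.ofReal_le_ofReal (Input.potential_initial_le hβ hαβ)

theorem isAdmissible_sqrt_three : IsAdmissible (Real.sqrt 3) (1 + 4 / (3 * Real.sqrt 3)) where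
  pos := by positivity
  le_two := Real.sqrt_le_iff.2 ⟨by norm_num, by norm_num⟩
  bound p _ _ := by
    have h3 : (0 : ℝ) < Real.sqrt 3 := by positivity
    have hs : Real.sqrt 3 * Real.sqrt 3 = 3 := Real.mul_self_sqrt (by norm_num)
    rw [add_sub_cancel_left, le_div_iff₀ (by positivity)]
    have : (1 - p) * (Real.sqrt 3 * p + 1 / Real.sqrt 3) * (3 * Real.sqrt 3) =
        (1 - p) * (3 * (Real.sqrt 3 * Real.sqrt 3) * p + 3) := by
      field_simp
    rw [this, hs]
    nlinarith [sq_nonneg (3 * p - 1)]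

theorem isAdmissible_two : IsAdmissible 2 (57 / 32) where
  pos := by norm_num
  le_two := le_rfl
  bound p _ _ := by nlinarith [sq_nonneg (8 * p - 3)]

end QuerySort

end

theorem mainTheorem5 :
    QuerySort.HasExpectedRatio (Real.sqrt 3) (1 + 4 / (3 * Real.sqrt 3)) ∧
      QuerySort.HasExpectedRatio 2 (57 / 32) := by
  exact ⟨QuerySort.isAdmissible_sqrt_three.hasExpectedRatio,
    QuerySort.isAdmissible_two.hasExpectedRatio⟩
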